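/- **Theorem (ergodic rate of the edge user).** *Setting.* Two base stations $i\in\{1,2\}$ serve an edge user $f$ with the help of a STAR-RIS with $K$ elements and transmission coefficient $\beta\in[0,1]$. The transmit SNR is $\rho>0$, and base station $i$ gives the power fractions $\zeta_{i,f}>0$ to the edge user and $\zeta_{i,c}>0$ to its center user. All links are Nakagami-$m$ faded, with positive shapes and spreads $(m_{if},\Omega_{if})$ for the direct link from $i$ to $f$, $(m_{iR},\Omega_{iR})$ for the link from $i$ to the surface, and $(m_{Rf},\Omega_{Rf})$ for the link from the surface to $f$. Put $$\Gamma_i(a,b,c)=\frac{\Gamma(m_{if}+a)\,\Gamma(m_{iR}+b)\,\Gamma(m_{Rf}+c)}{\Gamma(m_{if})\,\Gamma(m_{iR})\,\Gamma(m_{Rf})},$$ $$\mu_i=\frac{2K\sqrt{\beta\,\Omega_{if}\Omega_{iR}\Omega_{Rf}}\;\Gamma_i(\tfrac12,\tfrac12,\tfrac12)}{\sqrt{m_{iR}m_{Rf}m_{if}}}+\beta K^2\Omega_{iR}\Omega_{Rf}+\Omega_{if},$$ $$\mu_i^{(2)}=\frac{4\beta^{3/2}K^3\sqrt{\Omega_{if}}\,(\Omega_{iR}\Omega_{Rf})^{3/2}\,\Gamma_i(\tfrac12,\tfrac32,\tfrac32)}{\sqrt{m_{if}}\,(m_{iR}m_{Rf})^{3/2}}+6\beta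 K^2\Omega_{iR}\Omega_{if}\Omega_{Rf}+\frac{4K\,\Omega_{if}^{3/2}\sqrt{\beta\,\Omega_{iR}\Omega_{Rf}}\;\Gamma_i(\tfrac32,\tfrac12,\tfrac12)}{\sqrt{m_{iR}m_{Rf}}\;m_{if}^{3/2}}+\frac{\beta^2K^4\Omega_{iR}^2\Omega_{Rf}^2(m_{iR}+1)(m_{Rf}+1)}{m_{iR}m_{Rf}}+\frac{(m_{if}+1)\Omega_{if}^2}{m_{if}}$$ (the first and second moments of the effective channel gains), and $$\mu_V=\rho(\zeta_{1,f}\mu_1+\zeta_{2,f}\mu_2),\qquad \mu_V^{(2)}=\rho^2\big(\zeta_{1,f}^2\mu_1^{(2)}+2\zeta_{1,f}\zeta_{2,f}\mu_1\mu_2+\zeta_{2,f}^2\mu_2^{(2)}\big),$$ $$\mu_W=\rho(\zeta_{1,c}\mu_1+\zeta_{2,c}\mu_2)+1,\qquad \mu_W^{(2)}=\rho^2\big(\zeta_{1,c}^2\mu_1^{(2)}+2\zeta_{1,c}\zeta_{2,c}\mu_1\mu_2+\zeta_{2,c}^2\mu_2^{(2)}\big)+2\rho(\zeta_{1,c}\mu_1+\zeta_{2,c}\mu_2)+1.$$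 The Gamma laws matched to these moments have, for $X\in\{V,W\}$, shape and scale $$k_X=\frac{\mu_X^2}{\mu_X^{(2)}-\mu_X^2},\qquad \theta_X=\frac{\mu_X^{(2)}-\mu_X^2}{\mu_X}.$$ The SINR $\gamma_f$ of the edge user is modelled by the corresponding beta-prime density $$f_{\gamma_f}(x)=\frac{\theta_W}{\theta_V\,B(k_V,k_W)}\Big(\frac{x\theta_W}{\theta_V}\Big)^{k_V-1}\Big(\frac{x\theta_W}{\theta_V}+1\Big)^{-(k_V+k_W)},\qquad x>0,$$ with $B$ the Euler Beta function, and the ergodic rate is $\mathcal R_f=\int_0^\infty\log_2(1+x)\,f_{\gamma_f}(x)\,dx$. The Meijer G-function is $$G^{m,n}_{p,q}\Big(z\,\Big|\,{a_1,\dots,a_p\atop b_1,\dots,b_q}\Big)=\frac1{2\pi \mathrm i}\int_{\sigma-\mathrm i\infty}^{\sigma+\mathrm i\infty}\frac{\prod_{j\le m}\Gamma(b_j-s)\,\prod_{j\le n}\Gamma(1-a_j+s)}{\prod_{j>m}\Gamma(1-b_j+s)\,\prod_{j>n}\Gamma(a_j-s)}\,z^s\,ds,$$ along a vertical line that has the poles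 of $\Gamma(b_j-s)$, $j\le m$, on its right and the poles of $\Gamma(1-a_j+s)$, $j\le n$, on its left. *Claim.* The numbers $k_V,\theta_V,k_W,\theta_W$ are positive, the integral defining $\mathcal R_f$ converges, and $$\mathcal R_f=\frac{1}{\ln(2)\,\Lambda_f}\;G^{3,2}_{3,3}\Big(\frac{\theta_W}{\theta_V}\,\Big|\,{0,\;1-k_W,\;1\atop 0,\;0,\;k_V}\Big),\qquad \Lambda_f=B(k_V,k_W)\,\Gamma(k_V+k_W).$$ Here a separating vertical line exists, and along each such line the integral defining $G^{3,2}_{3,3}$ converges absolutely and has the same value. The convergence and the identity hold, more generally, for the beta-prime density with arbitrary real parameters $k_V,\theta_V,k_W,\theta_W>0$. -/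

import Mathlib

/-! ### The Meijer G-function, by its Mellin–Barnes integral along a vertical line -/

namespace MeijerG

/-- The Mellin–Barnes integrand of `G^{m,n}_{p,q}(z | a ; b)`:
`∏_{j ≤ m} Γ(b_j - s) ∏_{j ≤ n} Γ(1 - a_j + s) / (∏_{j > m} Γ(1 - b_j + s) ∏_{j > n} Γ(a_j - s)) z^s`.
The reciprocal of `Γ` is the entire function `1/Γ`, as `Complex.Gamma` is `0` at its poles. -/
noncomputable def integrand (m n : ℕ) {p q : ℕ} (a : Fin p → ℂ) (b : Fin q → ℂ) (z s : ℂ) : ℂ :=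
  (∏ j : Fin q, if j.val < m then Complex.Gamma (b j - s) else (Complex.Gamma (1 - b j + s))⁻¹) *
    (∏ j : Fin p, if j.val < n then Complex.Gamma (1 - a j + s) else (Complex.Gamma (a j - s))⁻¹) *
    z ^ s

/-- The line `Re s = σ` separates the poles `b_j + k` (`j ≤ m`, `k = 0, 1, 2, …`), which lie to
its right, from the poles `a_j - 1 - k` (`j ≤ n`, `k = 0, 1, 2, …`), which lie to its left. -/
def Separates (m n : ℕ) {p q : ℕ} (a : Fin p → ℂ) (b : Fin q → ℂ) (σ : ℝ) : Prop :=
  (∀ j : Fin q, j.val < m → ∀ k : ℕ, σ < (b j + k).re) ∧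
    (∀ j : Fin p, j.val < n → ∀ k : ℕ, (a j - 1 - k).re < σ)

/-- `(1 / 2πi) ∫ integrand ds` along the line `Re s = σ`, taken upwards. -/
noncomputable def lineIntegral (m n : ℕ) {p q : ℕ} (a : Fin p → ℂ) (b : Fin q → ℂ) (z : ℂ)
    (σ : ℝ) : ℂ :=
  (1 / (2 * (Real.pi : ℂ))) * ∫ t : ℝ, integrand m n a b z (σ + t * Complex.I)

end MeijerG

/-- `G^{m,n}_{p,q}(z | a ; b)` is well defined with value `w`: some vertical line separates the two
families of poles, and along every such line the Mellin–Barnes integral converges absolutely and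
has the value `w`. -/
def HasMeijerG (m n : ℕ) {p q : ℕ} (a : Fin p → ℂ) (b : Fin q → ℂ) (z w : ℂ) : Prop :=
  (∃ σ : ℝ, MeijerG.Separates m n a b σ) ∧
    ∀ σ : ℝ, MeijerG.Separates m n a b σ →
      MeasureTheory.Integrable
        (fun t : ℝ => MeijerG.integrand m n a b z (σ + t * Complex.I)) ∧
      MeijerG.lineIntegral m n a b z σ = w

open Classical in
/-- The Meijer G-function `G^{m,n}_{p,q}(z | a ; b)`, for parameters whose poles are separated by a
vertical line along which the Mellin–Barnes integral converges (the value is `0` otherwise). -/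
noncomputable def meijerG (m n : ℕ) {p q : ℕ} (a : Fin p → ℂ) (b : Fin q → ℂ) (z : ℂ) : ℂ :=
  if h : ∃ w, HasMeijerG m n a b z w then h.choose else 0

theorem HasMeijerG.meijerG_eq {m n p q : ℕ} {a : Fin p → ℂ} {b : Fin q → ℂ} {z w : ℂ}
    (h : HasMeijerG m n a b z w) : meijerG m n a b z = w := by
  have hex : ∃ w, HasMeijerG m n a b z w := ⟨w, h⟩
  obtain ⟨σ, hσ⟩ := h.1
  rw [meijerG, dif_pos hex, ← (h.2 σ hσ).2, (hex.choose_spec.2 σ hσ).2]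

/-! ### The beta-prime law of a ratio of Gamma variables, and the ergodic rate -/

/-- The density of the beta-prime law `β'(kV, kW, 1, θV / θW)`. -/
noncomputable def betaPrimePDF (kV θV kW θW x : ℝ) : ℝ :=
  if 0 < x then
    θW * (x * θW / θV) ^ (kV - 1) * (x * θW / θV + 1) ^ (-(kV + kW)) /
      (θV * ProbabilityTheory.beta kV kW)
  else 0

/-- The ergodic rate `∫₀^∞ log₂(1 + x) f(x) dx` for an SINR of density `f`. -/
noncomputable def ergodicRate (f : ℝ → ℝ) : ℝ :=
  ∫ x in Set.Ioi (0 : ℝ), Real.logb 2 (1 + x) * f x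

/-- `Λ = B(kV, kW) Γ(kV + kW)`. -/
noncomputable def rateNormalizer (kV kW : ℝ) : ℝ :=
  ProbabilityTheory.beta kV kW * Real.Gamma (kV + kW)

/-- `G^{3,2}_{3,3}(θW / θV | 0, 1 - kW, 1 ; 0, 0, kV)`. -/
noncomputable def rateMeijerG (kV θV kW θW : ℝ) : ℂ :=
  meijerG 3 2 ![0, 1 - (kW : ℂ), 1] ![0, 0, (kV : ℂ)] ((θW / θV : ℝ) : ℂ)

/-! ### Moment matching by a Gamma law -/

/-- Shape of the Gamma law with first moment `μ₁` and second moment `μ₂`. -/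
noncomputable def gammaShape (μ₁ μ₂ : ℝ) : ℝ := μ₁ ^ 2 / (μ₂ - μ₁ ^ 2)

/-- Scale of the Gamma law with first moment `μ₁` and second moment `μ₂`. -/
noncomputable def gammaScale (μ₁ μ₂ : ℝ) : ℝ := (μ₂ - μ₁ ^ 2) / μ₁

/-! ### The edge user of the two-cell STAR-RIS assisted CoMP-NOMA network -/

/-- The parameters on which the SINR of the edge user depends. The two base stations are indexed by
`Fin 2`; every link is Nakagami-`m` faded with shape `m` and spread `Ω`. -/
structure EdgeUserSystem where
  /-- number of elements of the STAR-RIS -/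
  K : ℕ
  /-- energy-splitting coefficient of the transmission region, in which the edge user lies -/
  β : ℝ
  /-- transmit signal-to-noise ratio -/
  ρ : ℝ
  /-- power allocation factors of the base stations to the edge user -/
  ζf : Fin 2 → ℝ
  /-- power allocation factors of the base stations to their center users -/
  ζc : Fin 2 → ℝ
  /-- shape and spread of the direct links from the base stations to the edge user -/
  mD : Fin 2 → ℝ
  ΩD : Fin 2 → ℝ
  /-- shape and spread of the links from the base stations to the STAR-RIS -/
  mR : Fin 2 → ℝ
  ΩR : Fin 2 → ℝ
  /-- shape and spread of the link from the STAR-RIS to the edge user -/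
  mU : ℝ
  ΩU : ℝ
  β_mem : β ∈ Set.Icc (0 : ℝ) 1
  ρ_pos : 0 < ρ
  ζf_pos : ∀ i, 0 < ζf i
  ζc_pos : ∀ i, 0 < ζc i
  mD_pos : ∀ i, 0 < mD i
  ΩD_pos : ∀ i, 0 < ΩD i
  mR_pos : ∀ i, 0 < mR i
  ΩR_pos : ∀ i, 0 < ΩR i
  mU_pos : 0 < mU
  ΩU_pos : 0 < ΩU

namespace EdgeUserSystem

/-- `Γ_m(a, b, c)` for base station `i`. -/
noncomputable def gammaRatio (S : EdgeUserSystem) (i : Fin 2) (a b c : ℝ) : ℝ :=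
  Real.Gamma (S.mD i + a) * Real.Gamma (S.mR i + b) * Real.Gamma (S.mU + c) /
    (Real.Gamma (S.mD i) * Real.Gamma (S.mR i) * Real.Gamma S.mU)

/-- First moment of the effective channel gain `Z_{i,f}`. -/
noncomputable def meanZ (S : EdgeUserSystem) (i : Fin 2) : ℝ :=
  2 * S.K * √(S.β * S.ΩD i * S.ΩR i * S.ΩU) * S.gammaRatio i (1 / 2) (1 / 2) (1 / 2) /
      √(S.mR i * S.mU * S.mD i) +
    S.β * S.K ^ 2 * S.ΩR i * S.ΩU + S.ΩD i

/-- Second moment of the effective channel gain `Z_{i,f}`. -/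
noncomputable def secondZ (S : EdgeUserSystem) (i : Fin 2) : ℝ :=
  4 * S.β ^ (3 / 2 : ℝ) * S.K ^ 3 * √(S.ΩD i) * (S.ΩR i * S.ΩU) ^ (3 / 2 : ℝ) *
      S.gammaRatio i (1 / 2) (3 / 2) (3 / 2) / (√(S.mD i) * (S.mR i * S.mU) ^ (3 / 2 : ℝ)) +
    6 * S.β * S.K ^ 2 * S.ΩR i * S.ΩD i * S.ΩU +
    4 * S.K * S.ΩD i ^ (3 / 2 : ℝ) * √(S.β * S.ΩR i * S.ΩU) *
      S.gammaRatio i (3 / 2) (1 / 2) (1 / 2) / (√(S.mR i * S.mU) * S.mD i ^ (3 / 2 : ℝ)) +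
    S.β ^ 2 * S.K ^ 4 * S.ΩR i ^ 2 * (S.mR i + 1) * (S.mU + 1) * S.ΩU ^ 2 / (S.mR i * S.mU) +
    (S.mD i + 1) * S.ΩD i ^ 2 / S.mD i

/-- First moment of the signal `V = ρ ζ_{1,f} Z_{1,f} + ρ ζ_{2,f} Z_{2,f}`. -/
noncomputable def meanV (S : EdgeUserSystem) : ℝ :=
  S.ρ * (S.ζf 0 * S.meanZ 0 + S.ζf 1 * S.meanZ 1)

/-- Second moment of the signal `V`. -/
noncomputable def secondV (S : EdgeUserSystem) : ℝ :=
  S.ρ ^ 2 * (S.ζf 0 ^ 2 * S.secondZ 0 + 2 * S.ζf 0 * S.ζf 1 * S.meanZ 0 * S.meanZ 1 +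
    S.ζf 1 ^ 2 * S.secondZ 1)

/-- First moment of interference plus noise, `W = ρ ζ_{1,c} Z_{1,f} + ρ ζ_{2,c} Z_{2,f} + 1`. -/
noncomputable def meanW (S : EdgeUserSystem) : ℝ :=
  S.ρ * (S.ζc 0 * S.meanZ 0 + S.ζc 1 * S.meanZ 1) + 1

/-- Second moment of interference plus noise `W`. -/
noncomputable def secondW (S : EdgeUserSystem) : ℝ :=
  S.ρ ^ 2 * (S.ζc 0 ^ 2 * S.secondZ 0 + 2 * S.ζc 0 * S.ζc 1 * S.meanZ 0 * S.meanZ 1 +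
    S.ζc 1 ^ 2 * S.secondZ 1) +
    2 * S.ρ * (S.ζc 0 * S.meanZ 0 + S.ζc 1 * S.meanZ 1) + 1

noncomputable def kV (S : EdgeUserSystem) : ℝ := gammaShape S.meanV S.secondV

noncomputable def θV (S : EdgeUserSystem) : ℝ := gammaScale S.meanV S.secondV

noncomputable def kW (S : EdgeUserSystem) : ℝ := gammaShape S.meanW S.secondW

noncomputable def θW (S : EdgeUserSystem) : ℝ := gammaScale S.meanW S.secondW

/-- The density of the SINR of the edge user. -/
noncomputable def sinrPDF (S : EdgeUserSystem) : ℝ → ℝ := betaPrimePDF S.kV S.θV S.kW S.θW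

end EdgeUserSystem

open MeasureTheory Set Filter Asymptotics
open scoped Topology

/-! The identity is Parseval's formula for the Mellin transform. Since `Γ(1 - s) = -s Γ(-s)`, the
Meijer integrand splits into `Γ(s + 1) Γ(-s) / (-s)`, the Mellin transform of `log (1 + x)` at `s`
(`hasMellin_log_one_add`), and `z ^ s Γ(kV - s) Γ(kW + s)`, which is `Λ` times the Mellin transform
of the beta-prime density at `1 - s` (`hasMellin_betaPrimePDF`). Mellin inversion of `log (1 + x)`
under the integral against the density, followed by Fubini (`mellinBarnes_betaPrime`), gives the
value on every line with `max (-1) (-kW) < σ < 0`; these are exactly the separating lines.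

For the network it remains to see that the matched variances are positive. The channel gain has the
moments of `(X + kYU)²` with independent Nakagami `X`, `Y`, `U` and `k = K√β`, and its variance is a
sum of nonnegative terms, one of them strictly positive. -/

/-! ### Mellin transforms of `(1 + x) ^ (-c)` and `log (1 + x)`. -/

theorem image_div_one_sub_Ioo : (fun y : ℝ => y / (1 - y)) '' Ioo 0 1 = Ioi 0 := by
  ext x
  constructor
  · rintro ⟨y, ⟨h0, h1⟩, rfl⟩
    exact div_pos h0 (sub_pos.2 h1)
  · intro hx
    have hx : 0 < x := hx
    refine ⟨x / (1 + x), ⟨by positivity, (div_lt_one (by positivity)).2 (by linarith)⟩, ?_⟩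
    have : 1 - x / (1 + x) = 1 / (1 + x) := by field_simp; ring
    simp only [this]
    field_simp

/-- The substitution `x = y / (1 - y)` turns the integral into the Beta integral `B(s, c - s)`. -/
theorem hasMellin_one_add_cpow_neg {s c : ℂ} (hs : 0 < s.re) (hc : s.re < c.re) :
    HasMellin (fun x : ℝ => ((1 + x : ℝ) : ℂ) ^ (-c)) s
      (Complex.Gamma s * Complex.Gamma (c - s) / Complex.Gamma c) := by
  have hderiv : ∀ y ∈ Ioo (0 : ℝ) 1,
      HasDerivWithinAt (fun y : ℝ => y / (1 - y)) (1 / (1 - y) ^ 2) (Ioo 0 1) y := by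
    intro y hy
    have h1 : (1 : ℝ) - y ≠ 0 := (sub_pos.2 hy.2).ne'
    have := (hasDerivAt_id y).div ((hasDerivAt_id y).const_sub 1) h1
    convert! this.hasDerivWithinAt using 1
    simp
  have hinj : InjOn (fun y : ℝ => y / (1 - y)) (Ioo 0 1) := by
    intro y hy z hz h
    have h1 : (1 : ℝ) - y ≠ 0 := (sub_pos.2 hy.2).ne'
    have h2 : (1 : ℝ) - z ≠ 0 := (sub_pos.2 hz.2).ne'
    have h : y / (1 - y) = z / (1 - z) := h
    rw [div_eq_div_iff h1 h2] at h
    linarith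
  have hsubst : ∀ y ∈ Ioo (0 : ℝ) 1,
      |1 / (1 - y) ^ 2| • (((y / (1 - y) : ℝ) : ℂ) ^ (s - 1) •
        ((1 + y / (1 - y) : ℝ) : ℂ) ^ (-c)) =
      (y : ℂ) ^ (s - 1) * (1 - (y : ℂ)) ^ (c - s - 1) := by
    intro y hy
    have h1 : 0 < 1 - y := sub_pos.2 hy.2
    have h1' : ((1 - y : ℝ) : ℂ) ≠ 0 := Complex.ofReal_ne_zero.2 h1.ne'
    have e1 : 1 + y / (1 - y) = (1 - y)⁻¹ := by field_simp; ring
    have hinv : ∀ w : ℂ, (((1 - y)⁻¹ : ℝ) : ℂ) ^ w = ((1 - y : ℝ) : ℂ) ^ (-w) := by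
      intro w
      rw [Complex.ofReal_inv, Complex.inv_cpow _ _ (by
        rw [Complex.arg_ofReal_of_nonneg h1.le]; exact Real.pi_pos.ne), Complex.cpow_neg]
    have e2 : ((1 / (1 - y) ^ 2 : ℝ) : ℂ) = ((1 - y : ℝ) : ℂ) ^ (-2 : ℂ) := by
      rw [Complex.cpow_neg, Complex.cpow_ofNat]; push_cast; simp
    rw [abs_of_pos (by positivity), e1, Complex.real_smul, e2, div_eq_mul_inv, Complex.ofReal_mul,
      Complex.mul_cpow_ofReal_nonneg hy.1.le (inv_pos.2 h1).le, hinv, hinv, smul_eq_mul]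
    have e3 : c - s - 1 = -2 + (-(s - 1) + -(-c)) := by ring
    have e4 : (1 : ℂ) - y = ((1 - y : ℝ) : ℂ) := by push_cast; rfl
    rw [e4, e3, Complex.cpow_add _ _ h1', Complex.cpow_add _ _ h1']
    ring
  have hcs : 0 < (c - s).re := by simpa using hc
  constructor
  · rw [MellinConvergent, ← image_div_one_sub_Ioo,
      integrableOn_image_iff_integrableOn_abs_deriv_smul measurableSet_Ioo hderiv hinj]
    refine IntegrableOn.congr_fun ?_ (fun y hy => (hsubst y hy).symm) measurableSet_Ioo
    exact (intervalIntegrable_iff_integrableOn_Ioo_of_le zero_le_one).1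
      (Complex.betaIntegral_convergent hs hcs)
  · rw [mellin, ← image_div_one_sub_Ioo,
      integral_image_eq_integral_abs_deriv_smul measurableSet_Ioo hderiv hinj,
      setIntegral_congr_fun measurableSet_Ioo hsubst, ← integral_Ioc_eq_integral_Ioo,
      ← intervalIntegral.integral_of_le zero_le_one]
    have := Complex.Gamma_mul_Gamma_eq_betaIntegral hs hcs
    rw [add_sub_cancel] at this
    rw [this, mul_div_cancel_left₀ _ (Complex.Gamma_ne_zero_of_re_pos (hs.trans hc))]
    rfl

theorem isBigO_log_one_add_atTop {ε : ℝ} (hε : 0 < ε) :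
    (fun x : ℝ => ((Real.log (1 + x) : ℝ) : ℂ)) =O[atTop] fun x : ℝ => x ^ ε := by
  refine IsBigO.of_bound (2 ^ ε / ε) ?_
  filter_upwards [eventually_ge_atTop 1] with x hx
  rw [Complex.norm_real, Real.norm_of_nonneg (Real.log_nonneg (by linarith)),
    Real.norm_of_nonneg (by positivity)]
  calc Real.log (1 + x) ≤ (1 + x) ^ ε / ε := Real.log_le_rpow_div (by linarith) hε
    _ ≤ (2 * x) ^ ε / ε := by gcongr; linarith
    _ = 2 ^ ε / ε * x ^ ε := by rw [Real.mul_rpow (by norm_num) (by linarith)]; ring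

/-- The exponent stays in the form `-b`, `b = -1`, that `mellinConvergent_of_isBigO_rpow` expects.
-/
theorem isBigO_log_one_add_nhdsGT_zero :
    (fun x : ℝ => ((Real.log (1 + x) : ℝ) : ℂ)) =O[𝓝[>] 0] fun x : ℝ => x ^ (-(-1 : ℝ)) := by
  refine IsBigO.of_bound 1 ?_
  filter_upwards [self_mem_nhdsWithin] with x hx
  have hx : 0 < x := hx
  rw [Complex.norm_real, Real.norm_of_nonneg (Real.log_nonneg (by linarith)), neg_neg,
    Real.rpow_one, Real.norm_of_nonneg hx.le]
  linarith [Real.log_le_sub_one_of_pos (show 0 < 1 + x by linarith)]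

theorem continuousOn_log_one_add :
    ContinuousOn (fun x : ℝ => ((Real.log (1 + x) : ℝ) : ℂ)) (Ioi 0) := by
  refine Complex.continuous_ofReal.comp_continuousOn (ContinuousOn.log (by fun_prop) ?_)
  intro x hx
  have hx : 0 < x := hx
  positivity

theorem isBigO_ofReal_cpow {l : Filter ℝ} (hl : ∀ᶠ x in l, 0 < x) (s : ℂ) :
    (fun x : ℝ => (x : ℂ) ^ s) =O[l] fun x : ℝ => x ^ s.re := by
  refine IsBigO.of_bound 1 ?_
  filter_upwards [hl] with x hx
  rw [Complex.norm_cpow_eq_rpow_re_of_pos hx, Real.norm_of_nonneg (by positivity), one_mul]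

/-- Integration by parts against `x ^ s / s` leaves the transform of `(1 + x)⁻¹` at `s + 1`. The
boundary terms vanish at `0` because `-1 < Re s`, and at infinity because `Re s < 0`. -/
theorem hasMellin_log_one_add {s : ℂ} (h₁ : -1 < s.re) (h₂ : s.re < 0) :
    HasMellin (fun x : ℝ => ((Real.log (1 + x) : ℝ) : ℂ)) s
      (Complex.Gamma (s + 1) * Complex.Gamma (-s) / -s) := by
  have hs0 : s ≠ 0 := by rintro rfl; simp at h₂
  have hconv : MellinConvergent (fun x : ℝ => ((Real.log (1 + x) : ℝ) : ℂ)) s := by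
    refine mellinConvergent_of_isBigO_rpow (a := s.re / 2) (b := -1)
      (continuousOn_log_one_add.locallyIntegrableOn measurableSet_Ioi) ?_ (by linarith)
      isBigO_log_one_add_nhdsGT_zero h₁
    exact isBigO_log_one_add_atTop (by linarith)
  refine ⟨hconv, ?_⟩
  obtain ⟨hA, hB⟩ := hasMellin_one_add_cpow_neg (s := s + 1) (c := 1)
    (by simpa using by linarith) (by simpa using h₂)
  have hprod : ∀ x ∈ Ioi (0 : ℝ), (x : ℂ) ^ (s + 1 - 1) • ((1 + x : ℝ) : ℂ) ^ (-1 : ℂ) =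
      s * (((1 + x)⁻¹ : ℝ) * ((x : ℂ) ^ s / s)) := by
    intro x _
    rw [add_sub_cancel_right, Complex.cpow_neg_one, Complex.ofReal_inv, smul_eq_mul]
    field_simp
  have hu : ∀ x ∈ Ioi (0 : ℝ), HasDerivAt (fun x : ℝ => ((Real.log (1 + x) : ℝ) : ℂ))
      (((1 + x)⁻¹ : ℝ) : ℂ) x := by
    intro x hx
    have hx : 0 < x := hx
    have := ((hasDerivAt_id x).const_add 1).log (by simp; positivity)
    simpa using this.ofReal_comp
  have hv : ∀ x ∈ Ioi (0 : ℝ), HasDerivAt (fun x : ℝ => (x : ℂ) ^ s / s) ((x : ℂ) ^ (s - 1)) x := by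
    intro x hx
    have hx : 0 < x := hx
    simpa using hasDerivAt_ofReal_cpow_const' (r := s - 1) hx.ne'
      fun h => hs0 (by linear_combination h)
  have hbound : ∀ (l : Filter ℝ) (e : ℝ), (∀ᶠ x in l, 0 < x) →
      ((fun x : ℝ => ((Real.log (1 + x) : ℝ) : ℂ)) =O[l] fun x : ℝ => x ^ e) →
      Tendsto (fun x : ℝ => x ^ (e + s.re)) l (𝓝 0) →
      Tendsto ((fun x : ℝ => ((Real.log (1 + x) : ℝ) : ℂ)) * fun x : ℝ => (x : ℂ) ^ s / s) l
        (𝓝 0) := by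
    intro l e hl hlog ht
    refine IsBigO.trans_tendsto ?_ ht
    have h := hlog.mul ((isBigO_ofReal_cpow hl s).const_mul_left s⁻¹)
    refine h.congr' (Eventually.of_forall fun x => ?_) ?_
    · simp only [Pi.mul_apply]; ring
    · filter_upwards [hl] with x hx
      rw [Real.rpow_add hx]
  have key := integral_Ioi_mul_deriv_eq_deriv_mul hu hv
    (a' := 0) (b' := 0)
    (hconv.congr_fun (fun x _ => by simp [mul_comm]) measurableSet_Ioi)
    (IntegrableOn.congr_fun (Integrable.const_mul hA s⁻¹) (fun x hx => by
      simp only [hprod x hx, Pi.mul_apply]; field_simp) measurableSet_Ioi)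
    (hbound _ _ self_mem_nhdsWithin isBigO_log_one_add_nhdsGT_zero (by
      have hp : 0 < -(-1) + s.re := by linarith
      have := (Real.continuousAt_rpow_const 0 (-(-1) + s.re) (Or.inr hp.le)).tendsto
      rw [Real.zero_rpow hp.ne'] at this
      exact this.mono_left nhdsWithin_le_nhds))
    -- With this `ε` the product is `O(x ^ (Re s / 2))`, a negative power.
    (hbound _ _ (eventually_gt_atTop 0) (isBigO_log_one_add_atTop (ε := -s.re / 2) (by linarith))
      (by
        have := tendsto_rpow_neg_atTop (y := -s.re / 2) (by linarith)
        convert this using 2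
        ring_nf))
  have hmel : s * ∫ x in Ioi (0 : ℝ), (((1 + x)⁻¹ : ℝ) : ℂ) * ((x : ℂ) ^ s / s) =
      Complex.Gamma (s + 1) * Complex.Gamma (-s) := by
    rw [← integral_const_mul, ← setIntegral_congr_fun measurableSet_Ioi hprod]
    rw [mellin] at hB
    rw [hB]
    simp
  rw [mellin]
  calc _ = ∫ x in Ioi (0 : ℝ), ((Real.log (1 + x) : ℝ) : ℂ) * (x : ℂ) ^ (s - 1) :=
        setIntegral_congr_fun measurableSet_Ioi fun x _ => by simp [mul_comm]
    _ = _ := by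
      rw [key, ← hmel]
      field_simp
      ring

/-! ### Integrability on vertical lines and Mellin inversion. -/

theorem Complex.normSq_sin (z : ℂ) :
    Complex.normSq (Complex.sin z) = Real.sin z.re ^ 2 + Real.sinh z.im ^ 2 := by
  rw [Complex.sin_eq z, Complex.normSq_apply]
  simp only [← Complex.ofReal_sin, ← Complex.ofReal_cos, ← Complex.ofReal_sinh,
    ← Complex.ofReal_cosh, ← Complex.ofReal_mul, Complex.add_re, Complex.add_im, Complex.ofReal_re,
    Complex.ofReal_im, Complex.re_ofReal_mul, Complex.im_ofReal_mul, Complex.I_re, Complex.I_im]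
  linear_combination Real.sin z.re ^ 2 * Real.cosh_sq z.im +
    Real.sinh z.im ^ 2 * Real.sin_sq_add_cos_sq z.re

theorem Real.sq_le_sinh_sq (t : ℝ) : t ^ 2 ≤ Real.sinh t ^ 2 := by
  rw [← sq_abs t, ← sq_abs (Real.sinh t), Real.abs_sinh]
  gcongr
  exact Real.self_le_sinh_iff.2 (abs_nonneg t)

theorem Gamma_add_one_mul_Gamma_neg (s : ℂ) :
    Complex.Gamma (s + 1) * Complex.Gamma (-s) = -(Real.pi / Complex.sin (Real.pi * s)) := by
  have := Complex.Gamma_mul_Gamma_one_sub (-s)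
  rw [sub_neg_eq_add, mul_neg, Complex.sin_neg, div_neg] at this
  rw [← this]; ring_nf

theorem continuous_logMellin_line {σ : ℝ} (h₁ : -1 < σ) (h₂ : σ < 0) :
    Continuous fun t : ℝ => Complex.Gamma (σ + t * Complex.I + 1) *
      Complex.Gamma (-(σ + t * Complex.I)) / -(σ + t * Complex.I) := by
  have hne : ∀ t : ℝ, (σ + t * Complex.I : ℂ) ≠ 0 := by
    intro t h
    have := congrArg Complex.re h
    simp at this
    exact h₂.ne this
  have hG : ∀ f : ℝ → ℂ, Continuous f → (∀ t, 0 < (f t).re) →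
      Continuous fun t => Complex.Gamma (f t) := by
    intro f hf hpos
    refine continuous_iff_continuousAt.2 fun t => ?_
    refine ContinuousAt.comp (f := f) (Complex.differentiableAt_Gamma _ fun m h => ?_).continuousAt
      hf.continuousAt
    have := hpos t
    rw [h] at this
    simp at this
    linarith [(Nat.cast_nonneg m : (0 : ℝ) ≤ m)]
  refine Continuous.div (Continuous.mul (hG _ (by fun_prop) fun t => ?_)
    (hG _ (by fun_prop) fun t => ?_)) (by fun_prop) fun t => neg_ne_zero.2 (hne t)
  · simp; linarith
  · simpa using h₂

/-- By the reflection formula the norm is `π / (|sin πs| |s|)`. As `|sin πs|² = sin² πσ + sinh² πt`,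
the crude bound `sinh² πt ≥ t²` already gives quadratic decay. -/
theorem verticalIntegrable_logMellin {σ : ℝ} (h₁ : -1 < σ) (h₂ : σ < 0) :
    Complex.VerticalIntegrable
      (fun s => Complex.Gamma (s + 1) * Complex.Gamma (-s) / -s) σ := by
  have hsin : Real.sin (Real.pi * σ) < 0 :=
    Real.sin_neg_of_neg_of_neg_pi_lt (by nlinarith [Real.pi_pos]) (by nlinarith [Real.pi_pos])
  -- This makes `c (1 + t²)` a lower bound for both `|sin πs|²` and `|s|²`; the coefficient of `t²`
  -- uses `c ≤ 1`.
  set c : ℝ := min (Real.sin (Real.pi * σ) ^ 2) (σ ^ 2)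
  have hc0 : 0 < c := lt_min (sq_pos_of_neg hsin) (sq_pos_of_neg h₂)
  have hc1 : c ≤ 1 := (min_le_left _ _).trans (Real.sin_sq_le_one _)
  refine Integrable.mono' (g := fun t : ℝ => Real.pi / c * (1 + t ^ 2)⁻¹)
    (integrable_inv_one_add_sq.const_mul _)
    (continuous_logMellin_line h₁ h₂).aestronglyMeasurable (Eventually.of_forall fun t => ?_)
  simp only
  rw [Gamma_add_one_mul_Gamma_neg, neg_div_neg_eq, norm_div, norm_div, Complex.norm_real,
    Real.norm_of_nonneg Real.pi_pos.le, div_div, ← div_eq_mul_inv, div_div]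
  have hpi : 1 ≤ Real.pi := by linarith [Real.pi_gt_three]
  have hbound : c * (1 + t ^ 2) ≤ ‖Complex.sin (Real.pi * (σ + t * Complex.I))‖ *
      ‖(σ + t * Complex.I : ℂ)‖ := by
    refine le_of_sq_le_sq ?_ (by positivity)
    rw [mul_pow, mul_pow, ← Complex.normSq_eq_norm_sq, ← Complex.normSq_eq_norm_sq,
      Complex.normSq_sin, Complex.normSq_add_mul_I, sq c]
    have e1 : c * (1 + t ^ 2) ≤ Real.sin (Real.pi * (σ + t * Complex.I : ℂ)).re ^ 2 +
        Real.sinh (Real.pi * (σ + t * Complex.I : ℂ)).im ^ 2 := by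
      have r1 : (Real.pi * (σ + t * Complex.I : ℂ)).re = Real.pi * σ := by simp
      have r2 : (Real.pi * (σ + t * Complex.I : ℂ)).im = Real.pi * t := by simp
      rw [r1, r2]
      have := Real.sq_le_sinh_sq (Real.pi * t)
      have := min_le_left (Real.sin (Real.pi * σ) ^ 2) (σ ^ 2)
      have h4 : t ^ 2 ≤ (Real.pi * t) ^ 2 := by
        rw [mul_pow]; exact le_mul_of_one_le_left (sq_nonneg t) (one_le_pow₀ hpi)
      nlinarith [sq_nonneg t]
    have e2 : c * (1 + t ^ 2) ≤ σ ^ 2 + t ^ 2 := by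
      have := min_le_right (Real.sin (Real.pi * σ) ^ 2) (σ ^ 2)
      nlinarith [sq_nonneg t]
    calc c * c * (1 + t ^ 2) ^ 2 = (c * (1 + t ^ 2)) * (c * (1 + t ^ 2)) := by ring
      _ ≤ _ := by gcongr
  gcongr

/-- The Mellin–Barnes representation of `log (1 + x)`. -/
theorem integral_cpow_mul_logMellin {σ x : ℝ} (h₁ : -1 < σ) (h₂ : σ < 0) (hx : 0 < x) :
    ∫ t : ℝ, (x : ℂ) ^ (-(σ + t * Complex.I)) * (Complex.Gamma (σ + t * Complex.I + 1) *
      Complex.Gamma (-(σ + t * Complex.I)) / -(σ + t * Complex.I)) =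
    2 * Real.pi * Real.log (1 + x) := by
  have hline : ∀ t : ℝ, mellin (fun x : ℝ => ((Real.log (1 + x) : ℝ) : ℂ)) (σ + t * Complex.I) =
      Complex.Gamma (σ + t * Complex.I + 1) *
        Complex.Gamma (-(σ + t * Complex.I)) / -(σ + t * Complex.I) := fun t =>
    (hasMellin_log_one_add (by simpa using h₁) (by simpa using h₂)).2
  have := mellinInv_mellin_eq σ (fun x : ℝ => ((Real.log (1 + x) : ℝ) : ℂ)) hx
    (hasMellin_log_one_add (by simpa using h₁) (by simpa using h₂)).1
    (by
      have := verticalIntegrable_logMellin h₁ h₂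
      rw [Complex.VerticalIntegrable] at this ⊢
      simpa only [hline] using this)
    (continuousOn_log_one_add.continuousAt (Ioi_mem_nhds hx))
  rw [mellinInv] at this
  simp only [hline, smul_eq_mul] at this
  have hpi : (2 * Real.pi : ℂ) ≠ 0 := by simp [Real.pi_ne_zero]
  rw [← this, Complex.real_smul, ← mul_assoc]
  push_cast
  rw [mul_one_div_cancel hpi, one_mul]

/-! ### Nakagami moments and positivity of the matched variances. -/

/-- Log-convexity of `Γ` at the midpoint of `m` and `m + 1`. -/
theorem Real.Gamma_add_half_sq_le {m : ℝ} (hm : 0 < m) :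
    Real.Gamma (m + 1 / 2) ^ 2 ≤ m * Real.Gamma m ^ 2 := by
  have h := Real.Gamma_mul_add_mul_le_rpow_Gamma_mul_rpow_Gamma hm (show 0 < m + 1 by linarith)
    (show (0 : ℝ) < 1 / 2 by norm_num) (show (0 : ℝ) < 1 / 2 by norm_num) (by norm_num)
  have hG := Real.Gamma_pos_of_pos hm
  rw [show 1 / 2 * m + 1 / 2 * (m + 1) = m + 1 / 2 by ring, Real.Gamma_add_one hm.ne',
    ← Real.sqrt_eq_rpow, ← Real.sqrt_eq_rpow, ← Real.sqrt_mul hG.le] at h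
  have h' := pow_le_pow_left₀ (Real.Gamma_pos_of_pos (by linarith)).le h 2
  rw [Real.sq_sqrt (by positivity)] at h'
  linarith

theorem Real.Gamma_add_three_halves {m : ℝ} (hm : 0 < m) :
    Real.Gamma (m + 3 / 2) = (m + 1 / 2) * Real.Gamma (m + 1 / 2) := by
  rw [← Real.Gamma_add_one (by linarith)]; ring_nf

/-- The mean of a Nakagami variable of shape `m` and spread `Ω`. -/
noncomputable def nakagamiMean (m Ω : ℝ) : ℝ :=
  √Ω / √m * (Real.Gamma (m + 1 / 2) / Real.Gamma m)

theorem nakagamiMean_pos {m Ω : ℝ} (hm : 0 < m) (hΩ : 0 < Ω) : 0 < nakagamiMean m Ω := by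
  have := Real.Gamma_pos_of_pos hm
  have := Real.Gamma_pos_of_pos (show 0 < m + 1 / 2 by linarith)
  unfold nakagamiMean
  positivity

theorem nakagamiMean_sq_le {m Ω : ℝ} (hm : 0 < m) (hΩ : 0 < Ω) : nakagamiMean m Ω ^ 2 ≤ Ω := by
  have hG := Real.Gamma_pos_of_pos hm
  have h := Real.Gamma_add_half_sq_le hm
  rw [nakagamiMean, mul_pow, div_pow, div_pow, Real.sq_sqrt hΩ.le, Real.sq_sqrt hm.le,
    div_mul_div_comm, div_le_iff₀ (by positivity)]
  exact mul_le_mul_of_nonneg_left h hΩ.le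

theorem Real.rpow_three_halves {x : ℝ} (hx : 0 ≤ x) : x ^ (3 / 2 : ℝ) = x * √x := by
  -- The endpoint is needed because `β` may be `0`.
  rcases hx.eq_or_lt with rfl | hx
  · norm_num
  · rw [show (3 / 2 : ℝ) = 1 + 1 / 2 by norm_num, Real.rpow_add hx, Real.rpow_one,
      ← Real.sqrt_eq_rpow]

namespace EdgeUserSystem

variable (S : EdgeUserSystem) (i : Fin 2)

/-- This is `E (X + kYU)²` expanded, with `k = K√β` and `E X² = Ω`. -/
theorem meanZ_eq : S.meanZ i =
    2 * (S.K * √S.β) * nakagamiMean (S.mD i) (S.ΩD i) * nakagamiMean (S.mR i) (S.ΩR i) *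
      nakagamiMean S.mU S.ΩU + (S.K * √S.β) ^ 2 * S.ΩR i * S.ΩU + S.ΩD i := by
  have h1 := S.mD_pos i
  have h2 := S.mR_pos i
  have h3 := S.mU_pos
  have h4 := S.ΩD_pos i
  have h5 := S.ΩR_pos i
  have h7 := S.β_mem.1
  rw [meanZ, gammaRatio, Real.sqrt_mul (by positivity), Real.sqrt_mul (by positivity),
    Real.sqrt_mul h7, Real.sqrt_mul (by positivity), Real.sqrt_mul h2.le, mul_pow (S.K : ℝ),
    Real.sq_sqrt h7]
  simp only [nakagamiMean]
  ring

/-- This is `E (X + kYU)⁴` expanded; for a Nakagami variable `E X³ = Ω (1 + 1/(2m)) E X` and `E X⁴ =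
Ω² (1 + 1/m)`. -/
theorem secondZ_eq : S.secondZ i =
    4 * (S.K * √S.β) ^ 3 * nakagamiMean (S.mD i) (S.ΩD i) *
        (S.ΩR i * (1 + 1 / (2 * S.mR i)) * nakagamiMean (S.mR i) (S.ΩR i)) *
        (S.ΩU * (1 + 1 / (2 * S.mU)) * nakagamiMean S.mU S.ΩU) +
      6 * (S.K * √S.β) ^ 2 * S.ΩR i * S.ΩD i * S.ΩU +
      4 * (S.K * √S.β) * (S.ΩD i * (1 + 1 / (2 * S.mD i)) * nakagamiMean (S.mD i) (S.ΩD i)) *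
        nakagamiMean (S.mR i) (S.ΩR i) * nakagamiMean S.mU S.ΩU +
      (S.K * √S.β) ^ 4 * (S.ΩR i ^ 2 * (1 + 1 / S.mR i)) * (S.ΩU ^ 2 * (1 + 1 / S.mU)) +
      S.ΩD i ^ 2 * (1 + 1 / S.mD i) := by
  have h1 := S.mD_pos i
  have h2 := S.mR_pos i
  have h3 := S.mU_pos
  have h4 := S.ΩD_pos i
  have h5 := S.ΩR_pos i
  have h6 := S.ΩU_pos
  have h7 := S.β_mem.1
  have g1 := Real.Gamma_pos_of_pos h1
  have g2 := Real.Gamma_pos_of_pos h2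
  have g3 := Real.Gamma_pos_of_pos h3
  have hβ : √S.β ^ 2 = S.β := Real.sq_sqrt h7
  have hβ3 : √S.β ^ 3 = S.β * √S.β := by rw [pow_succ, hβ]
  have hβ4 : √S.β ^ 4 = S.β ^ 2 := by rw [show 4 = 2 * 2 from rfl, pow_mul, hβ]
  rw [secondZ, gammaRatio, gammaRatio, Real.Gamma_add_three_halves h1,
    Real.Gamma_add_three_halves h2, Real.Gamma_add_three_halves h3,
    Real.rpow_three_halves h7, Real.rpow_three_halves (by positivity : 0 ≤ S.ΩR i * S.ΩU),
    Real.rpow_three_halves (by positivity : 0 ≤ S.mR i * S.mU), Real.rpow_three_halves h1.le,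
    Real.rpow_three_halves h4.le, Real.sqrt_mul (by positivity : 0 ≤ S.β * S.ΩR i),
    Real.sqrt_mul h7, Real.sqrt_mul h5.le, Real.sqrt_mul h2.le]
  simp only [nakagamiMean, mul_pow, hβ, hβ3, hβ4]
  field_simp

theorem meanZ_pos : 0 < S.meanZ i := by
  have h1 := nakagamiMean_pos (S.mD_pos i) (S.ΩD_pos i)
  have h2 := nakagamiMean_pos (S.mR_pos i) (S.ΩR_pos i)
  have h3 := nakagamiMean_pos S.mU_pos S.ΩU_pos
  have h4 := S.ΩD_pos i
  have h5 := S.ΩR_pos i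
  have h6 := S.ΩU_pos
  rw [meanZ_eq]
  positivity

theorem meanZ_sq_lt_secondZ : S.meanZ i ^ 2 < S.secondZ i := by
  have m1 := S.mD_pos i
  have m2 := S.mR_pos i
  have m3 := S.mU_pos
  have o1 := S.ΩD_pos i
  have o2 := S.ΩR_pos i
  have o3 := S.ΩU_pos
  have p1 := nakagamiMean_pos m1 o1
  have p2 := nakagamiMean_pos m2 o2
  have p3 := nakagamiMean_pos m3 o3
  have q1 := nakagamiMean_sq_le m1 o1
  have q2 := nakagamiMean_sq_le m2 o2
  have q3 := nakagamiMean_sq_le m3 o3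
  rw [meanZ_eq, secondZ_eq]
  set a := nakagamiMean (S.mD i) (S.ΩD i)
  set b := nakagamiMean (S.mR i) (S.ΩR i)
  set c := nakagamiMean S.mU S.ΩU
  have hk : 0 ≤ S.K * √S.β := by positivity
  generalize S.K * √S.β = k at hk
  have e1 : (0 : ℝ) < 1 / S.mD i := by positivity
  have e2 : (0 : ℝ) < 1 / S.mR i := by positivity
  have e3 : (0 : ℝ) < 1 / S.mU := by positivity
  simp only [one_div, mul_inv] at e1 e2 e3 ⊢
  generalize (S.mD i)⁻¹ = u at *
  generalize (S.mR i)⁻¹ = v at *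
  generalize S.mU⁻¹ = w at *
  generalize S.ΩD i = A at *
  generalize S.ΩR i = B at *
  generalize S.ΩU = C at *
  -- The variance is the sum of `t1`, …, `t5` below. Only `t1` needs the bounds on the means; `t2`,
  -- from the direct link alone, keeps the inequality strict even when `k = 0`.
  have hcov : a ^ 2 * b ^ 2 * c ^ 2 ≤ A * B * C := by gcongr
  have t1 : 0 ≤ 4 * k ^ 2 * (A * B * C - a ^ 2 * b ^ 2 * c ^ 2) :=
    mul_nonneg (by positivity) (sub_nonneg.2 hcov)
  have t2 : 0 < A ^ 2 * u := by positivity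
  have t3 : 0 ≤ 4 * k * a * b * c * (A * u / 2) := by positivity
  have t4 : 0 ≤ 4 * k ^ 3 * a * b * c * B * C * (v / 2 + w / 2 + v * w / 4) := by positivity
  have t5 : 0 ≤ k ^ 4 * B ^ 2 * C ^ 2 * (v + w + v * w) := by positivity
  linear_combination t1 + t2 + t3 + t4 + t5

theorem meanV_pos : 0 < S.meanV := by
  have := S.ρ_pos
  simp only [meanV]
  have h0 := mul_pos (S.ζf_pos 0) (S.meanZ_pos 0)
  have h1 := mul_pos (S.ζf_pos 1) (S.meanZ_pos 1)
  positivity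

theorem meanW_pos : 0 < S.meanW := by
  have := S.ρ_pos
  have h0 := mul_pos (S.ζc_pos 0) (S.meanZ_pos 0)
  have h1 := mul_pos (S.ζc_pos 1) (S.meanZ_pos 1)
  simp only [meanW]
  positivity

/-- The cross terms cancel, leaving `ρ² ∑ ζ² Var Z`. For `W` the constant noise term cancels too. -/
theorem meanV_sq_lt_secondV : S.meanV ^ 2 < S.secondV := by
  have h0 := mul_pos (pow_pos (S.ζf_pos 0) 2) (sub_pos.2 (S.meanZ_sq_lt_secondZ 0))
  have h1 := mul_pos (pow_pos (S.ζf_pos 1) 2) (sub_pos.2 (S.meanZ_sq_lt_secondZ 1))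
  have h := mul_pos (pow_pos S.ρ_pos 2) (add_pos h0 h1)
  simp only [meanV, secondV]
  linear_combination h

theorem meanW_sq_lt_secondW : S.meanW ^ 2 < S.secondW := by
  have h0 := mul_pos (pow_pos (S.ζc_pos 0) 2) (sub_pos.2 (S.meanZ_sq_lt_secondZ 0))
  have h1 := mul_pos (pow_pos (S.ζc_pos 1) 2) (sub_pos.2 (S.meanZ_sq_lt_secondZ 1))
  have h := mul_pos (pow_pos S.ρ_pos 2) (add_pos h0 h1)
  simp only [meanW, secondW]
  linear_combination h

end EdgeUserSystem

theorem gammaShape_pos {μ₁ μ₂ : ℝ} (h₁ : 0 < μ₁) (h : μ₁ ^ 2 < μ₂) : 0 < gammaShape μ₁ μ₂ :=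
  div_pos (pow_pos h₁ 2) (sub_pos.2 h)

theorem gammaScale_pos {μ₁ μ₂ : ℝ} (h₁ : 0 < μ₁) (h : μ₁ ^ 2 < μ₂) : 0 < gammaScale μ₁ μ₂ :=
  div_pos (sub_pos.2 h) h₁

/-! ### The beta-prime density and the Mellin–Barnes integral. -/

theorem rateNormalizer_pos {kV kW : ℝ} (hkV : 0 < kV) (hkW : 0 < kW) :
    0 < rateNormalizer kV kW :=
  mul_pos (ProbabilityTheory.beta_pos hkV hkW) (Real.Gamma_pos_of_pos (by positivity))

theorem measurable_betaPrimePDF (kV θV kW θW : ℝ) : Measurable (betaPrimePDF kV θV kW θW) := by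
  unfold betaPrimePDF
  exact Measurable.ite measurableSet_Ioi (by fun_prop) measurable_const

/-- Rescaling by `r = θW / θV` leaves the transform of `(1 + y) ^ (-(kV + kW))` at `kV - s`. The
scaling factor `r ^ (s - 1)` and the `r` in the density combine to `r ^ s`. -/
theorem hasMellin_betaPrimePDF {kV θV kW θW : ℝ} (hkV : 0 < kV) (hθV : 0 < θV) (hkW : 0 < kW)
    (hθW : 0 < θW) {s : ℂ} (h₁ : -kW < s.re) (h₂ : s.re < kV) :
    HasMellin (fun x : ℝ => (betaPrimePDF kV θV kW θW x : ℂ)) (1 - s)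
      (((θW / θV : ℝ) : ℂ) ^ s * (Complex.Gamma (kV - s) * Complex.Gamma (kW + s)) /
        (rateNormalizer kV kW : ℝ)) := by
  set r : ℝ := θW / θV with hr
  have hr0 : 0 < r := by positivity
  set B := ProbabilityTheory.beta kV kW with hB
  have hB0 : 0 < B := ProbabilityTheory.beta_pos hkV hkW
  set g : ℝ → ℂ := fun y =>
    ((r / B : ℝ) : ℂ) • ((y : ℂ) ^ ((kV : ℂ) - 1) • ((1 + y : ℝ) : ℂ) ^ (-((kV : ℂ) + kW))) with hg
  have hfg : ∀ x ∈ Ioi (0 : ℝ), (betaPrimePDF kV θV kW θW x : ℂ) = g (r * x) := by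
    intro x hx
    have hx : 0 < x := hx
    have e : x * θW / θV = r * x := by rw [hr]; ring
    have h0 : 0 ≤ r * x := by positivity
    have h1 : 0 ≤ 1 + r * x := by positivity
    have c1 : ((r * x : ℝ) : ℂ) ^ ((kV : ℂ) - 1) = (((r * x) ^ (kV - 1) : ℝ) : ℂ) := by
      rw [Complex.ofReal_cpow h0]; push_cast; rfl
    have c2 : ((1 + r * x : ℝ) : ℂ) ^ (-((kV : ℂ) + kW)) =
        (((1 + r * x) ^ (-(kV + kW)) : ℝ) : ℂ) := by
      rw [Complex.ofReal_cpow h1]; push_cast; rfl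
    simp only [hg]
    rw [betaPrimePDF, if_pos hx, e, add_comm (r * x) 1, c1, c2, smul_eq_mul, smul_eq_mul,
      ← Complex.ofReal_mul, ← Complex.ofReal_mul, hr, ← hB]
    congr 1
    field_simp
  have hbase := hasMellin_one_add_cpow_neg (s := 1 - s + (kV - 1)) (c := (kV : ℂ) + kW)
    (by simpa using h₂) (by simp; linarith)
  have hconv : MellinConvergent g (1 - s) :=
    (MellinConvergent.cpow_smul.2 hbase.1).const_smul ((r / B : ℝ) : ℂ)
  have hval : mellin g (1 - s) = ((r / B : ℝ) : ℂ) *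
      (Complex.Gamma (kV - s) * Complex.Gamma (kW + s) / Complex.Gamma (kV + kW)) := by
    simp only [hg]
    rw [mellin_const_smul, mellin_cpow_smul, hbase.2, smul_eq_mul]
    congr 4 <;> ring_nf
  constructor
  · exact ((MellinConvergent.comp_mul_left hr0).2 hconv).congr_fun
      (fun x hx => by simp only [hfg x hx]) measurableSet_Ioi
  · have : mellin (fun x : ℝ => (betaPrimePDF kV θV kW θW x : ℂ)) (1 - s) =
        mellin (fun x => g (r * x)) (1 - s) :=
      setIntegral_congr_fun measurableSet_Ioi fun x hx => by simp only [hfg x hx]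
    have hrC : (r : ℂ) ≠ 0 := Complex.ofReal_ne_zero.2 hr0.ne'
    rw [this, mellin_comp_mul_left g _ hr0, hval, smul_eq_mul, neg_sub, Complex.cpow_sub _ _ hrC,
      Complex.cpow_one, rateNormalizer, ← hB, Complex.ofReal_mul B, ← Complex.Gamma_ofReal,
      Complex.ofReal_add, Complex.ofReal_div r]
    have hBC : (B : ℂ) ≠ 0 := Complex.ofReal_ne_zero.2 hB0.ne'
    field_simp

theorem integrand_rateMeijerG {kV kW : ℝ} {z s : ℂ} (hs : s ≠ 0) (hs' : Complex.Gamma (-s) ≠ 0) :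
    MeijerG.integrand 3 2 ![0, 1 - (kW : ℂ), 1] ![0, 0, (kV : ℂ)] z s =
      Complex.Gamma (s + 1) * Complex.Gamma (-s) / -s *
        (z ^ s * (Complex.Gamma (kV - s) * Complex.Gamma (kW + s))) := by
  have h : Complex.Gamma (1 - s) = -s * Complex.Gamma (-s) := by
    rw [← Complex.Gamma_add_one _ (neg_ne_zero.2 hs)]; ring_nf
  simp [MeijerG.integrand, Fin.prod_univ_three, h]
  rw [add_comm 1 s]
  field_simp

/-- The Mellin–Barnes formula for the mean of `log (1 + X)`, `X` a beta-prime variable. -/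
theorem mellinBarnes_betaPrime {kV θV kW θW : ℝ} (hkV : 0 < kV) (hθV : 0 < θV) (hkW : 0 < kW)
    (hθW : 0 < θW) {σ : ℝ} (h₁ : -1 < σ) (h₂ : -kW < σ) (h₃ : σ < 0) :
    IntegrableOn (fun x : ℝ => Real.log (1 + x) * betaPrimePDF kV θV kW θW x) (Ioi 0) ∧
    Integrable (fun t : ℝ => MeijerG.integrand 3 2 ![0, 1 - (kW : ℂ), 1] ![0, 0, (kV : ℂ)]
      ((θW / θV : ℝ) : ℂ) (σ + t * Complex.I)) ∧
    MeijerG.lineIntegral 3 2 ![0, 1 - (kW : ℂ), 1] ![0, 0, (kV : ℂ)] ((θW / θV : ℝ) : ℂ) σ =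
      ((rateNormalizer kV kW *
        ∫ x in Ioi (0 : ℝ), Real.log (1 + x) * betaPrimePDF kV θV kW θW x : ℝ) : ℂ) := by
  set f := betaPrimePDF kV θV kW θW
  set Φ : ℝ → ℂ := fun t => Complex.Gamma (σ + t * Complex.I + 1) *
    Complex.Gamma (-(σ + t * Complex.I)) / -(σ + t * Complex.I) with hΦ
  have hΦm : Measurable Φ := (continuous_logMellin_line h₁ h₃).measurable
  have hΦi : Integrable Φ := verticalIntegrable_logMellin h₁ h₃
  have hfm : Measurable f := measurable_betaPrimePDF kV θV kW θW
  set μ : Measure ℝ := volume.restrict (Ioi 0)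
  have hpos : ∀ᵐ x ∂μ, 0 < x := ae_restrict_mem measurableSet_Ioi
  have hMellin : ∀ t : ℝ, HasMellin (fun x => (f x : ℂ)) (1 - (σ + t * Complex.I)) _ := fun t =>
    hasMellin_betaPrimePDF hkV hθV hkW hθW (by simpa using h₂) (by simpa using h₃.trans hkV)
  set F : ℝ → ℝ → ℂ := fun x t => (x : ℂ) ^ (-(σ + t * Complex.I)) * Φ t * f x with hF
  have hFint : Integrable (Function.uncurry F) (μ.prod volume) := by
    -- `‖x ^ (-s)‖` depends only on `Re s`, so `‖F‖` is a product of a function of `x`, integrable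
    -- by Mellin convergence at `t = 0`, and `‖Φ t‖`.
    have h0 : Integrable (fun x : ℝ => (x : ℂ) ^ (1 - (σ + (0 : ℝ) * Complex.I) - 1) • (f x : ℂ)) μ :=
      (hMellin 0).1
    refine (h0.norm.mul_prod hΦi.norm).mono' ?_ ?_
    · have : Measurable (Function.uncurry F) := by
        simp only [hF, Function.uncurry_def]
        fun_prop
      exact this.aestronglyMeasurable
    · filter_upwards [Measure.quasiMeasurePreserving_fst.ae hpos] with p hp
      simp only [hF, Function.uncurry_def, norm_mul, norm_smul,
        Complex.norm_cpow_eq_rpow_re_of_pos hp]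
      simp
      apply le_of_eq
      ring
  have hinner : ∀ x ∈ Ioi (0 : ℝ), ∫ t : ℝ, F x t =
      ((2 * Real.pi * (Real.log (1 + x) * f x) : ℝ) : ℂ) := by
    intro x hx
    simp only [hF]
    rw [integral_mul_const, integral_cpow_mul_logMellin h₁ h₃ hx]
    push_cast
    ring
  have hΛ : (rateNormalizer kV kW : ℂ) ≠ 0 :=
    Complex.ofReal_ne_zero.2 (rateNormalizer_pos hkV hkW).ne'
  have houter : ∀ t : ℝ, MeijerG.integrand 3 2 ![0, 1 - (kW : ℂ), 1] ![0, 0, (kV : ℂ)]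
      ((θW / θV : ℝ) : ℂ) (σ + t * Complex.I) = rateNormalizer kV kW * ∫ x, F x t ∂μ := by
    intro t
    have hre : (-(σ + t * Complex.I : ℂ)).re = -σ := by simp
    have hs : (σ + t * Complex.I : ℂ) ≠ 0 := by
      intro h
      rw [h] at hre
      simp at hre
      exact h₃.ne hre
    have hval := (hMellin t).2
    rw [integrand_rateMeijerG hs (Complex.Gamma_ne_zero_of_re_pos (by linarith))]
    have : ∫ x, F x t ∂μ = Φ t * mellin (fun x => (f x : ℂ)) (1 - (σ + t * Complex.I)) := by
      rw [mellin, ← integral_const_mul]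
      refine integral_congr_ae (Eventually.of_forall fun x => ?_)
      simp only [hF, smul_eq_mul]
      rw [show (1 - (σ + t * Complex.I) - 1 : ℂ) = -(σ + t * Complex.I) by ring]
      ring
    rw [this, hval]
    simp only [hΦ]
    field_simp
  refine ⟨?_, ?_, ?_⟩
  -- Convergence of the rate integral comes from Fubini: integrating `F` over `t` gives `2π log (1 +
  -- x) f x`.
  · have h := hFint.integral_prod_left
    have h' : IntegrableOn (fun x => ((2 * Real.pi * (Real.log (1 + x) * f x) : ℝ) : ℂ)) (Ioi 0) :=
      IntegrableOn.congr_fun h hinner measurableSet_Ioi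
    have h'' := (h'.re).const_mul (2 * Real.pi)⁻¹
    refine h''.congr (Eventually.of_forall fun x => ?_)
    have := Real.pi_ne_zero
    simp only [RCLike.re_to_complex, Complex.ofReal_re]
    field_simp
  · simp only [houter]
    exact hFint.integral_prod_right.const_mul _
  · rw [MeijerG.lineIntegral]
    simp only [houter]
    rw [integral_const_mul, ← integral_integral_swap hFint,
      setIntegral_congr_fun measurableSet_Ioi hinner, integral_complex_ofReal,
      integral_const_mul]
    have : (Real.pi : ℂ) ≠ 0 := Complex.ofReal_ne_zero.2 Real.pi_ne_zero
    push_cast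
    field_simp
    rfl

/-! ### The separating strip and the ergodic rate. -/

/-- Only the nearest poles `0`, `-1` and `-kW` matter: those starting at `kV > 0` lie to the right
of `0`, and the parameter `a₃ = 1` enters only through the denominator. -/
theorem separates_rateMeijerG {kV kW σ : ℝ} (hkV : 0 < kV) :
    MeijerG.Separates 3 2 ![0, 1 - (kW : ℂ), 1] ![0, 0, (kV : ℂ)] σ ↔
      -1 < σ ∧ -kW < σ ∧ σ < 0 := by
  constructor
  · rintro ⟨hb, ha⟩
    refine ⟨?_, ?_, ?_⟩
    · simpa using ha 0 (by simp) 0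
    · simpa using ha 1 (by simp) 0
    · simpa using hb 0 (by simp) 0
  · rintro ⟨h₁, h₂, h₃⟩
    constructor
    · intro j _ k
      have hk : (0 : ℝ) ≤ k := Nat.cast_nonneg k
      fin_cases j <;> simp <;> linarith
    · intro j hj k
      have hk : (0 : ℝ) ≤ k := Nat.cast_nonneg k
      fin_cases j
      · simp; linarith
      · simp; linarith
      · simp at hj

theorem ergodicRate_betaPrimePDF {kV θV kW θW : ℝ} (hkV : 0 < kV) (hθV : 0 < θV) (hkW : 0 < kW)
    (hθW : 0 < θW) :
    IntegrableOn (fun x : ℝ => Real.logb 2 (1 + x) * betaPrimePDF kV θV kW θW x) (Ioi 0) ∧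
    HasMeijerG 3 2 ![0, 1 - (kW : ℂ), 1] ![0, 0, (kV : ℂ)] ((θW / θV : ℝ) : ℂ)
      (rateMeijerG kV θV kW θW) ∧
    (ergodicRate (betaPrimePDF kV θV kW θW) : ℂ) =
      1 / ((Real.log 2 * rateNormalizer kV kW : ℝ) : ℂ) * rateMeijerG kV θV kW θW := by
  have hlogb : ∀ x : ℝ, Real.logb 2 (1 + x) * betaPrimePDF kV θV kW θW x =
      (Real.log 2)⁻¹ * (Real.log (1 + x) * betaPrimePDF kV θV kW θW x) := by
    intro x
    rw [Real.logb]
    ring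
  have hG : HasMeijerG 3 2 ![0, 1 - (kW : ℂ), 1] ![0, 0, (kV : ℂ)] ((θW / θV : ℝ) : ℂ)
      ((rateNormalizer kV kW *
        ∫ x in Ioi (0 : ℝ), Real.log (1 + x) * betaPrimePDF kV θV kW θW x : ℝ) : ℂ) := by
    refine ⟨?_, fun σ hσ => ?_⟩
    · obtain ⟨σ, hσ, hσ'⟩ := exists_between (max_lt (neg_one_lt_zero (R := ℝ)) (neg_neg_of_pos hkW))
      exact ⟨σ, (separates_rateMeijerG hkV).2
        ⟨(le_max_left _ _).trans_lt hσ, (le_max_right _ _).trans_lt hσ, hσ'⟩⟩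
    · obtain ⟨h₁, h₂, h₃⟩ := (separates_rateMeijerG hkV).1 hσ
      exact (mellinBarnes_betaPrime hkV hθV hkW hθW h₁ h₂ h₃).2
  have hval : rateMeijerG kV θV kW θW = _ := hG.meijerG_eq
  refine ⟨?_, hval ▸ hG, ?_⟩
  · obtain ⟨σ, hσ⟩ := hG.1
    obtain ⟨h₁, h₂, h₃⟩ := (separates_rateMeijerG hkV).1 hσ
    simp only [hlogb]
    exact (mellinBarnes_betaPrime hkV hθV hkW hθW h₁ h₂ h₃).1.const_mul _
  · have hΛ : (rateNormalizer kV kW : ℂ) ≠ 0 :=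
      Complex.ofReal_ne_zero.2 (rateNormalizer_pos hkV hkW).ne'
    have hlog : (Real.log 2 : ℂ) ≠ 0 :=
      Complex.ofReal_ne_zero.2 (Real.log_pos one_lt_two).ne'
    rw [hval, ergodicRate]
    simp only [hlogb]
    rw [integral_const_mul]
    simp only [Complex.ofReal_mul, Complex.ofReal_inv]
    field_simp

theorem mainTheorem1 :
    -- the identity for the beta-prime law with arbitrary positive parameters
    (∀ kV θV kW θW : ℝ, 0 < kV → 0 < θV → 0 < kW → 0 < θW →
      MeasureTheory.IntegrableOn
        (fun x : ℝ => Real.logb 2 (1 + x) * betaPrimePDF kV θV kW θW x) (Set.Ioi 0) ∧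
      HasMeijerG 3 2 ![0, 1 - (kW : ℂ), 1] ![0, 0, (kV : ℂ)] ((θW / θV : ℝ) : ℂ)
        (rateMeijerG kV θV kW θW) ∧
      (ergodicRate (betaPrimePDF kV θV kW θW) : ℂ) =
        1 / ((Real.log 2 * rateNormalizer kV kW : ℝ) : ℂ) * rateMeijerG kV θV kW θW) ∧
    -- the edge user of the network, with the moment-matched parameters
    (∀ S : EdgeUserSystem,
      (0 < S.kV ∧ 0 < S.θV ∧ 0 < S.kW ∧ 0 < S.θW) ∧
      MeasureTheory.IntegrableOn (fun x : ℝ => Real.logb 2 (1 + x) * S.sinrPDF x) (Set.Ioi 0) ∧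
      HasMeijerG 3 2 ![0, 1 - (S.kW : ℂ), 1] ![0, 0, (S.kV : ℂ)] ((S.θW / S.θV : ℝ) : ℂ)
        (rateMeijerG S.kV S.θV S.kW S.θW) ∧
      (ergodicRate S.sinrPDF : ℂ) =
        1 / ((Real.log 2 * rateNormalizer S.kV S.kW : ℝ) : ℂ) *
          rateMeijerG S.kV S.θV S.kW S.θW) := by
  refine ⟨fun kV θV kW θW hkV hθV hkW hθW => ergodicRate_betaPrimePDF hkV hθV hkW hθW, fun S => ?_⟩
  have hkV : 0 < S.kV := gammaShape_pos S.meanV_pos S.meanV_sq_lt_secondV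
  have hθV : 0 < S.θV := gammaScale_pos S.meanV_pos S.meanV_sq_lt_secondV
  have hkW : 0 < S.kW := gammaShape_pos S.meanW_pos S.meanW_sq_lt_secondW
  have hθW : 0 < S.θW := gammaScale_pos S.meanW_pos S.meanW_sq_lt_secondW
  exact ⟨⟨hkV, hθV, hkW, hθW⟩, ergodicRate_betaPrimePDF hkV hθV hkW hθW⟩
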